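/- For a finite group $G$, let $D(G)$ be the Drinfel'd double of $G$ over $\mathbb{C}$: the Hopf algebra with basis $e_g\otimes x$ ($g,x\in G$), product $(e_g\otimes x)(e_h\otimes y)=\delta_{g,\,xhx^{-1}}\,e_g\otimes xy$, unit $\sum_g e_g\otimes 1$, comultiplication $\Delta(e_g\otimes x)=\sum_{ab=g}(e_a\otimes x)\otimes(e_b\otimes x)$ and counit $\varepsilon(e_g\otimes x)=\delta_{g,1}$. Let $\Lambda=|G|^{-1}\sum_{x\in G}e_1\otimes x$ be its normalized integral. For $n\ge 1$ put $\Lambda^{[n]}=\Lambda_1\Lambda_2\cdots\Lambda_n$ (Sweedler notation), and for an irreducible representation $V$ of $D(G)$ with character $\chi_V$ let $\nu_n(V)=\chi_V(\Lambda^{[n]})$ be the $n$-th Frobenius–Schur indicator of $V$. The finite group $G$ is called an $FSZ$-group if $\nu_n(V)\in\mathbb{Z}$ for every integer $n\ge 1$ and every irreducible representation $V$ of $D(G)$. Corollary. For every $N\ge 0$ the alternating group $A_N$ is an $FSZ$-group. -/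

import Mathlib

open scoped TensorProduct

/-! ### Higher Frobenius-Schur indicators of a finite-dimensional Hopf algebra -/

section Hopf

variable {H : Type*} [Ring H] [HopfAlgebra ℂ H]

/-- The Sweedler power `h ↦ h^{[n]} = h₁ h₂ ⋯ hₙ` (with `h^{[0]} = ε(h) 1`):
`h^{[n+1]} = (h₁)^{[n]} h₂`. -/
noncomputable def sweedlerPow (H : Type*) [Ring H] [HopfAlgebra ℂ H] : ℕ → (H →ₗ[ℂ] H)
  | 0 => Algebra.linearMap ℂ H ∘ₗ Coalgebra.counit
  | n + 1 => LinearMap.mul' ℂ H ∘ₗ (sweedlerPow H n).rTensor H ∘ₗ Coalgebra.comul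

/-- `Λ` is a normalized (two-sided) integral of the Hopf algebra `H`. -/
structure IsNormalizedIntegral (Λ : H) : Prop where
  mul_left : ∀ h : H, h * Λ = (Coalgebra.counit h : ℂ) • Λ
  mul_right : ∀ h : H, Λ * h = (Coalgebra.counit h : ℂ) • Λ
  counit_eq_one : (Coalgebra.counit Λ : ℂ) = 1

/-- A normalized integral is unique. -/
theorem IsNormalizedIntegral.unique {Λ Λ' : H} (h : IsNormalizedIntegral Λ)
    (h' : IsNormalizedIntegral Λ') : Λ = Λ' := by
  have h1 := h'.mul_left Λ
  have h2 := h.mul_right Λ'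
  rw [h.counit_eq_one, one_smul] at h1
  rw [h'.counit_eq_one, one_smul] at h2
  exact h2.symm.trans h1

/-- The character `χ_V : H → ℂ` of an `H`-module `V`. -/
noncomputable def moduleCharacter (H : Type*) [Ring H] [Algebra ℂ H] (V : Type*) [AddCommGroup V]
    [Module ℂ V] [Module H V] [IsScalarTower ℂ H V] : H →ₗ[ℂ] ℂ :=
  LinearMap.trace ℂ V ∘ₗ (Algebra.lsmul ℂ ℂ V : H →ₐ[ℂ] Module.End ℂ V).toLinearMap

/-- The `n`-th Frobenius-Schur indicator `χ_V(Λ^{[n]})` of an `H`-module `V`, where `Λ` is the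
normalized integral of `H`. -/
noncomputable def fsIndicator (Λ : H) (n : ℕ) (V : Type*) [AddCommGroup V]
    [Module ℂ V] [Module H V] [IsScalarTower ℂ H V] : ℂ :=
  moduleCharacter H V (sweedlerPow H n Λ)

end Hopf

/-! ### The Drinfel'd double of a finite group -/

/-- The underlying space of the Drinfel'd double `D(G) = ℂ^G ⊗ ℂG`, an element being given by
its coordinates in the basis `e_g ⊗ x` with `g, x ∈ G`. -/
def DrinfeldDouble (G : Type*) : Type _ := G × G → ℂ

namespace DrinfeldDouble

variable {G : Type*}

noncomputable instance : AddCommGroup (DrinfeldDouble G) :=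
  inferInstanceAs (AddCommGroup (G × G → ℂ))

noncomputable instance : Module ℂ (DrinfeldDouble G) :=
  inferInstanceAs (Module ℂ (G × G → ℂ))

theorem add_apply (f h : DrinfeldDouble G) (p : G × G) : (f + h) p = f p + h p := rfl

theorem smul_apply (c : ℂ) (f : DrinfeldDouble G) (p : G × G) : (c • f) p = c * f p := rfl

theorem zero_apply (p : G × G) : (0 : DrinfeldDouble G) p = 0 := rfl

@[ext] theorem ext {f h : DrinfeldDouble G} (H : ∀ p, f p = h p) : f = h := funext H

theorem sum_apply {ι : Type*} (s : Finset ι) (f : ι → DrinfeldDouble G) (p : G × G) :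
    (∑ i ∈ s, f i) p = ∑ i ∈ s, f i p :=
  Finset.sum_apply p s f

variable [Fintype G] [DecidableEq G]

/-- The basis of `D(G)` formed by the elements `e_g ⊗ x`. -/
noncomputable def basis (G : Type*) [Fintype G] [DecidableEq G] :
    Module.Basis (G × G) ℂ (DrinfeldDouble G) :=
  Pi.basisFun ℂ (G × G)

instance : FiniteDimensional ℂ (DrinfeldDouble G) := (basis G).finiteDimensional_of_finite

/-- The basis element `e_g ⊗ x`. -/
noncomputable abbrev e (g x : G) : DrinfeldDouble G := basis G (g, x)

theorem e_apply (g x : G) (p : G × G) : e g x p = if p.1 = g ∧ p.2 = x then 1 else 0 := by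
  have : e g x p = (Pi.single (g, x) 1 : G × G → ℂ) p := by
    rw [← Pi.basisFun_apply]; rfl
  rw [this, Pi.single_apply]
  simp [Prod.ext_iff]

variable [Group G]

/-- The product is determined by `(e_g ⊗ x)(e_h ⊗ y) = δ_{g, x h x⁻¹} e_g ⊗ xy`,
see `e_mul_e`. -/
noncomputable instance : Mul (DrinfeldDouble G) where
  mul f h := fun p => ∑ y : G, f (p.1, y) * h (y⁻¹ * p.1 * y, y⁻¹ * p.2)

/-- The unit is `∑_g e_g ⊗ 1`. -/
noncomputable instance : One (DrinfeldDouble G) where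
  one := fun p => if p.2 = 1 then 1 else 0

theorem mul_apply {K : Type*} [Group K] [Fintype K] (f h : DrinfeldDouble K) (p : K × K) :
    (f * h) p = ∑ y : K, f (p.1, y) * h (y⁻¹ * p.1 * y, y⁻¹ * p.2) := rfl

theorem one_apply {K : Type*} [Group K] [DecidableEq K] (p : K × K) :
    (1 : DrinfeldDouble K) p = if p.2 = 1 then 1 else 0 := rfl

theorem one_eq_sum : (1 : DrinfeldDouble G) = ∑ g : G, e g 1 := by
  ext ⟨a, b⟩
  rw [sum_apply, one_apply]
  by_cases hb : b = 1 <;> simp [e_apply, hb]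

theorem e_mul_e (g x h y : G) :
    e g x * e h y = if g = x * h * x⁻¹ then e g (x * y) else 0 := by
  ext ⟨a, b⟩
  rw [mul_apply, Finset.sum_eq_single x]
  · have h1 : x⁻¹ * a * x = h ↔ a = x * h * x⁻¹ := by
      constructor
      · rintro rfl; group
      · rintro rfl; group
    simp only [e_apply, h1, inv_mul_eq_iff_eq_mul]
    by_cases hg : g = x * h * x⁻¹
    · rw [if_pos hg, e_apply]
      subst hg
      by_cases ha : a = x * h * x⁻¹ <;> simp [ha]
    · rw [if_neg hg, zero_apply]
      by_cases ha : a = g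
      · subst ha; simp [hg]
      · simp [ha]
  · intro z _ hz
    simp [e_apply, hz]
  · simp

noncomputable instance : Ring (DrinfeldDouble G) :=
  { (inferInstance : AddCommGroup (DrinfeldDouble G)),
    (inferInstance : Mul (DrinfeldDouble G)),
    (inferInstance : One (DrinfeldDouble G)) with
    mul_assoc := by
      intro f h k
      ext ⟨g, x⟩
      simp only [mul_apply, Finset.sum_mul, Finset.mul_sum]
      rw [Finset.sum_comm]
      refine Finset.sum_congr rfl fun y _ => ?_
      refine Fintype.sum_equiv (Equiv.mulLeft y⁻¹) _ _ fun z => ?_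
      simp [mul_assoc]
    one_mul := by
      intro f
      ext ⟨g, x⟩
      simp [mul_apply, one_apply]
    mul_one := by
      intro f
      ext ⟨g, x⟩
      simp [mul_apply, one_apply, inv_mul_eq_one]
    left_distrib := by
      intro f h k
      ext p
      simp [mul_apply, add_apply, mul_add, Finset.sum_add_distrib]
    right_distrib := by
      intro f h k
      ext p
      simp [mul_apply, add_apply, add_mul, Finset.sum_add_distrib]
    zero_mul := by
      intro f
      ext p
      simp [mul_apply, zero_apply]
    mul_zero := by
      intro f
      ext p
      simp [mul_apply, zero_apply]
    zsmul := fun n f => n • f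
    zsmul_zero' := fun f => zero_zsmul f
    zsmul_succ' := fun n f => SubNegMonoid.zsmul_succ' n f
    zsmul_neg' := fun n f => SubNegMonoid.zsmul_neg' n f
    neg_add_cancel := fun f => neg_add_cancel f }

noncomputable instance : Algebra ℂ (DrinfeldDouble G) :=
  Algebra.ofModule
    (by
      intro c f h
      ext p
      simp [mul_apply, smul_apply, Finset.mul_sum, mul_assoc])
    (by
      intro c f h
      ext p
      simp only [mul_apply, smul_apply, Finset.mul_sum]
      exact Finset.sum_congr rfl fun y _ => by ring)

/-- The comultiplication `Δ(e_g ⊗ x) = ∑_{ab = g} (e_a ⊗ x) ⊗ (e_b ⊗ x)`. -/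
noncomputable def comulMap (G : Type*) [Group G] [Fintype G] [DecidableEq G] :
    DrinfeldDouble G →ₗ[ℂ] DrinfeldDouble G ⊗[ℂ] DrinfeldDouble G :=
  (basis G).constr ℂ fun p => ∑ a : G, e a p.2 ⊗ₜ[ℂ] e (a⁻¹ * p.1) p.2

/-- The counit `ε(e_g ⊗ x) = δ_{g, 1}`. -/
noncomputable def counitMap (G : Type*) [Group G] [Fintype G] [DecidableEq G] :
    DrinfeldDouble G →ₗ[ℂ] ℂ :=
  (basis G).constr ℂ fun p => if p.1 = 1 then 1 else 0

/-- The antipode `S(e_g ⊗ x) = e_{x⁻¹ g⁻¹ x} ⊗ x⁻¹`. -/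
noncomputable def antipodeMap (G : Type*) [Group G] [Fintype G] [DecidableEq G] :
    DrinfeldDouble G →ₗ[ℂ] DrinfeldDouble G :=
  (basis G).constr ℂ fun p => e (p.2⁻¹ * p.1⁻¹ * p.2) p.2⁻¹

theorem comulMap_e (g x : G) :
    comulMap G (e g x) = ∑ a : G, e a x ⊗ₜ[ℂ] e (a⁻¹ * g) x :=
  (basis G).constr_basis ℂ _ _

theorem counitMap_e (g x : G) : counitMap G (e g x) = if g = 1 then 1 else 0 :=
  (basis G).constr_basis ℂ _ _

theorem antipodeMap_e (g x : G) : antipodeMap G (e g x) = e (x⁻¹ * g⁻¹ * x) x⁻¹ :=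
  (basis G).constr_basis ℂ _ _

noncomputable instance : Coalgebra ℂ (DrinfeldDouble G) where
  comul := comulMap G
  counit := counitMap G
  coassoc := by
    refine (basis G).ext fun ⟨g, x⟩ => ?_
    simp only [LinearMap.comp_apply, comulMap_e, map_sum, LinearMap.rTensor_tmul,
      LinearMap.lTensor_tmul, TensorProduct.sum_tmul, TensorProduct.tmul_sum,
      LinearEquiv.coe_coe, TensorProduct.assoc_tmul]
    rw [Finset.sum_comm]
    refine Finset.sum_congr rfl fun a _ => ?_
    refine Fintype.sum_equiv (Equiv.mulLeft a⁻¹) _ _ fun b => ?_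
    simp [mul_assoc]
  rTensor_counit_comp_comul := by
    refine (basis G).ext fun ⟨g, x⟩ => ?_
    simp only [LinearMap.comp_apply, comulMap_e, map_sum, LinearMap.rTensor_tmul, counitMap_e]
    rw [Finset.sum_eq_single 1] <;> simp +contextual
  lTensor_counit_comp_comul := by
    refine (basis G).ext fun ⟨g, x⟩ => ?_
    simp only [LinearMap.comp_apply, comulMap_e, map_sum, LinearMap.lTensor_tmul, counitMap_e]
    rw [Finset.sum_eq_single g]
    · simp
    · intro a _ ha
      simp [inv_mul_eq_one, ha]
    · simp

theorem comul_e (g x : G) :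
    Coalgebra.comul (R := ℂ) (e g x) = ∑ a : G, e a x ⊗ₜ[ℂ] e (a⁻¹ * g) x :=
  comulMap_e g x

theorem counit_e (g x : G) : Coalgebra.counit (R := ℂ) (e g x) = if g = 1 then 1 else 0 :=
  counitMap_e g x

noncomputable instance : Bialgebra ℂ (DrinfeldDouble G) where
  counit_one := by simp [one_eq_sum, counit_e]
  mul_compr₂_counit := by
    refine LinearMap.ext_basis (basis G) (basis G) fun ⟨g, x⟩ ⟨h, y⟩ => ?_
    simp only [LinearMap.compr₂_apply, LinearMap.compl₁₂_apply, LinearMap.mul_apply', e_mul_e,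
      counit_e]
    by_cases hg : g = 1
    · subst hg
      have : (1 = x * h * x⁻¹) ↔ h = 1 := by rw [eq_comm, conj_eq_one_iff]
      by_cases hh : h = 1 <;> simp [this, hh, counit_e]
    · rw [if_neg hg, zero_mul]
      by_cases hh : g = x * h * x⁻¹
      · rw [if_pos hh, counit_e, if_neg hg]
      · rw [if_neg hh, map_zero]
  comul_one := by
    rw [one_eq_sum, map_sum, Algebra.TensorProduct.one_def, one_eq_sum, TensorProduct.sum_tmul]
    simp only [comul_e, TensorProduct.tmul_sum]
    rw [Finset.sum_comm]
    refine Finset.sum_congr rfl fun a _ => ?_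
    exact Fintype.sum_equiv (Equiv.mulLeft a⁻¹) _ _ fun b => by simp
  mul_compr₂_comul := by
    refine LinearMap.ext_basis (basis G) (basis G) fun ⟨g, x⟩ ⟨h, y⟩ => ?_
    simp only [LinearMap.compr₂_apply, LinearMap.compl₁₂_apply, LinearMap.mul_apply', e_mul_e,
      comul_e, Finset.sum_mul_sum, Algebra.TensorProduct.tmul_mul_tmul]
    have key : ∀ a : G, (∑ b : G,
        (if a = x * b * x⁻¹ then e a (x * y) else 0) ⊗ₜ[ℂ]
          (if a⁻¹ * g = x * (b⁻¹ * h) * x⁻¹ then e (a⁻¹ * g) (x * y) else 0)) =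
        if g = x * h * x⁻¹ then e a (x * y) ⊗ₜ[ℂ] e (a⁻¹ * g) (x * y) else 0 := by
      intro a
      rw [Finset.sum_eq_single (x⁻¹ * a * x)]
      · have h1 : a = x * (x⁻¹ * a * x) * x⁻¹ := by group
        have h2 : x * ((x⁻¹ * a * x)⁻¹ * h) * x⁻¹ = a⁻¹ * (x * h * x⁻¹) := by group
        rw [if_pos h1, h2]
        by_cases hg : g = x * h * x⁻¹ <;> simp [hg]
      · intro b _ hb
        rw [if_neg, TensorProduct.zero_tmul]
        rintro rfl
        apply hb
        group
      · simp
    simp only [key]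
    by_cases hg : g = x * h * x⁻¹
    · simp only [if_pos hg, comul_e]
    · simp [if_neg hg]

noncomputable instance : HopfAlgebra ℂ (DrinfeldDouble G) where
  antipode := antipodeMap G
  mul_antipode_rTensor_comul := by
    refine (basis G).ext fun ⟨g, x⟩ => ?_
    simp only [LinearMap.comp_apply, comul_e, map_sum, LinearMap.rTensor_tmul, antipodeMap_e,
      LinearMap.mul'_apply, e_mul_e, counit_e, Algebra.linearMap_apply]
    have h1 : ∀ a : G, x⁻¹ * a⁻¹ * x = x⁻¹ * (a⁻¹ * g) * x⁻¹⁻¹ ↔ g = 1 := by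
      intro a
      simp [mul_assoc]
    simp only [h1]
    by_cases hg : g = 1
    · simp only [hg, if_true, map_one, one_eq_sum, inv_mul_cancel]
      refine Fintype.sum_equiv ((Equiv.inv G).trans (MulAut.conj x⁻¹).toEquiv) _ _ fun a => ?_
      simp [mul_assoc]
    · simp [hg]
  mul_antipode_lTensor_comul := by
    refine (basis G).ext fun ⟨g, x⟩ => ?_
    simp only [LinearMap.comp_apply, comul_e, map_sum, LinearMap.lTensor_tmul, antipodeMap_e,
      LinearMap.mul'_apply, e_mul_e, counit_e, Algebra.linearMap_apply]
    have h1 : ∀ a : G, a = x * (x⁻¹ * (a⁻¹ * g)⁻¹ * x) * x⁻¹ ↔ g = 1 := by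
      intro a
      simp [mul_assoc]
    simp only [h1]
    by_cases hg : g = 1
    · simp [hg, one_eq_sum]
    · simp [hg]

/-- The normalized integral `Λ = |G|⁻¹ ∑_x e_1 ⊗ x` of `D(G)`. -/
noncomputable def integral (G : Type*) [Group G] [Fintype G] [DecidableEq G] : DrinfeldDouble G :=
  (Fintype.card G : ℂ)⁻¹ • ∑ x : G, e 1 x

theorem isNormalizedIntegral_integral : IsNormalizedIntegral (integral G) where
  mul_left := by
    intro k
    have : LinearMap.mulRight ℂ (integral G) =
        (Coalgebra.counit (R := ℂ) (A := DrinfeldDouble G)).smulRight (integral G) := by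
      refine (basis G).ext fun ⟨g, x⟩ => ?_
      simp only [LinearMap.mulRight_apply, LinearMap.smulRight_apply, counit_e, integral,
        mul_smul_comm, Finset.mul_sum, e_mul_e]
      by_cases hg : g = 1
      · subst hg
        simp only [mul_one, mul_inv_cancel, if_true, one_smul]
        congr 1
        exact Fintype.sum_equiv (Equiv.mulLeft x) _ _ fun b => by simp
      · simp [hg]
    exact LinearMap.congr_fun this k
  mul_right := by
    intro k
    have : LinearMap.mulLeft ℂ (integral G) =
        (Coalgebra.counit (R := ℂ) (A := DrinfeldDouble G)).smulRight (integral G) := by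
      refine (basis G).ext fun ⟨g, x⟩ => ?_
      simp only [LinearMap.mulLeft_apply, LinearMap.smulRight_apply, counit_e, integral,
        smul_mul_assoc, Finset.sum_mul, e_mul_e]
      have h1 : ∀ b : G, 1 = b * g * b⁻¹ ↔ g = 1 := fun b => by
        rw [eq_comm, conj_eq_one_iff]
      simp only [h1]
      by_cases hg : g = 1
      · simp only [hg, if_true, one_smul]
        congr 1
        exact Fintype.sum_equiv (Equiv.mulRight x) _ _ fun b => by simp
      · simp [hg]
    exact LinearMap.congr_fun this k
  counit_eq_one := by
    simp [integral, counit_e]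

/-- An irreducible `D(G)`-module is finite-dimensional. -/
theorem finiteDimensional_of_isSimpleModule (V : Type*) [AddCommGroup V] [Module ℂ V]
    [Module (DrinfeldDouble G) V] [IsScalarTower ℂ (DrinfeldDouble G) V]
    [IsSimpleModule (DrinfeldDouble G) V] : FiniteDimensional ℂ V :=
  Module.Finite.trans (DrinfeldDouble G) V

end DrinfeldDouble

/-! ### `FSZ`-groups -/

/-- `G` is an `FSZ_n`-group: the `n`-th indicator of every irreducible representation `V` of
`D(G)` is an integer. Every irreducible representation is a quotient of `D(G)`, so those in the
universe of `G` are all of them up to isomorphism. -/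
def IsFSZn.{u} (G : Type u) [Group G] [Fintype G] [DecidableEq G] (n : ℕ) : Prop :=
  ∀ (V : Type u) [AddCommGroup V] [Module ℂ V] [Module (DrinfeldDouble G) V]
    [IsScalarTower ℂ (DrinfeldDouble G) V] [IsSimpleModule (DrinfeldDouble G) V],
    ∃ k : ℤ, fsIndicator (DrinfeldDouble.integral G) n V = (k : ℂ)

/-- `G` is an `FSZ`-group: it is `FSZ_n` for all positive integers `n`. -/
def IsFSZ (G : Type*) [Group G] [Fintype G] [DecidableEq G] : Prop :=
  ∀ n : ℕ, 0 < n → IsFSZn G n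

/-! Expand ν_n(V) as |G|⁻¹ times the sum over a, g of `commonRootCount n a g`, which counts the y
with yⁿ = (ay)ⁿ = g, times χ_V(e_a ⊗ g⁻¹) (`fsIndicator_integral_eq_sum`). If these counts do not
change when g is replaced by gᵐ with m prime to |G|, averaging over m shows that the indicator is
rational (`exists_rat_fsIndicator`). For n > 0 it is also an algebraic integer, being the trace on
the n-th tensor power of V of a cyclic shift times a commuting projection
(`isIntegral_fsIndicator`). This gives the criterion `isFSZn_of_commonRootCount_pow_eq`.

The counts are compared in any permutation group H that contains all squares, such as A_N. To turn
common roots y, ay of g into n-th roots of gᵐ, multiply y on the right by a permutation acting on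
each cycle of g as a power g^{2γ}; it is a square, so it lies in H. The exponents γ must suit y and
ay at once: Hall's theorem supplies a common transversal for the cycles of suitable powers of both
(`Equiv.Perm.exists_twist_of_period`). Letting γ depend only on how y permutes the cycles of g makes
the map on roots injective (`commonRootCount_le_pow`), and an inverse exponent gives the opposite
inequality. -/

section SweedlerPowers

/-! ### Sweedler powers in D(G) -/

open DrinfeldDouble

variable {G : Type*} [Group G] [Fintype G] [DecidableEq G]

theorem sweedlerPow_succ_e (n : ℕ) (g x : G) :
    sweedlerPow (DrinfeldDouble G) (n + 1) (e g x) =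
      ∑ b : G, sweedlerPow (DrinfeldDouble G) n (e b x) * e (b⁻¹ * g) x := by
  simp only [sweedlerPow, LinearMap.comp_apply, comul_e, map_sum, LinearMap.rTensor_tmul,
    LinearMap.mul'_apply]

theorem sweedlerPow_zero_e (g x : G) :
    sweedlerPow (DrinfeldDouble G) 0 (e g x) = if g = 1 then 1 else 0 := by
  simp only [sweedlerPow, LinearMap.comp_apply, counit_e, Algebra.linearMap_apply]
  split_ifs <;> simp

/-- A product of elements e_{a_k} ⊗ x survives only if each label is the x⁻¹-conjugate of the one
before, so the first label a determines the tuple, and a · x⁻¹ax · x⁻²ax² ⋯ telescopes to (ax⁻¹)ⁿxⁿ.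
-/
theorem sweedlerPow_e (n : ℕ) (g x : G) :
    sweedlerPow (DrinfeldDouble G) n (e g x) =
      ∑ a : G, if (a * x⁻¹) ^ n * x ^ n = g then e a (x ^ n) else 0 := by
  induction n generalizing g with
  | zero =>
    rw [sweedlerPow_zero_e]
    by_cases hg : g = 1
    · simp [hg, one_eq_sum]
    · simp [hg, Ne.symm hg]
  | succ n ih =>
    rw [sweedlerPow_succ_e]
    simp only [ih, Finset.sum_mul]
    rw [Finset.sum_comm]
    refine Finset.sum_congr rfl fun a _ => ?_
    rw [Finset.sum_eq_single ((a * x⁻¹) ^ n * x ^ n)]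
    · rw [if_pos rfl, e_mul_e, ← pow_succ]
      refine if_congr ?_ rfl rfl
      have h : (a * x⁻¹) ^ (n + 1) * x ^ (n + 1) = (a * x⁻¹) ^ n * (a * x ^ n) := by
        rw [pow_succ, pow_succ' x]; group
      rw [h]
      generalize (a * x⁻¹) ^ n = q
      generalize x ^ n = p
      constructor
      · intro h1
        rw [← mul_inv_eq_iff_eq_mul, inv_inv] at h1
        rw [h1]
        group
      · rintro rfl
        group
    · intro b _ hb
      rw [if_neg (Ne.symm hb), zero_mul]
    · simp

theorem List.prod_ofFn_snoc {M : Type*} [Monoid M] {n : ℕ} {A : Type*} (f : A → M) (a : Fin n → A)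
    (b : A) :
    (List.ofFn fun k => f ((Fin.snoc a b : Fin (n + 1) → A) k)).prod =
      (List.ofFn fun k => f (a k)).prod * f b := by
  rw [List.ofFn_succ', List.concat_eq_append, List.prod_append]
  simp

/-- The uncollapsed form, whose terms match those of the action on an n-fold tensor power. -/
theorem sweedlerPow_e_eq_sum_tuples (n : ℕ) (g x : G) :
    sweedlerPow (DrinfeldDouble G) n (e g x) =
      ∑ a : Fin n → G, if (List.ofFn a).prod = g then (List.ofFn fun k => e (a k) x).prod
        else 0 := by
  induction n generalizing g with
  | zero =>
    rw [sweedlerPow_zero_e]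
    simp [eq_comm]
  | succ n ih =>
    have hprod (a : Fin n → G) (b : G) :
        (List.ofFn ((Fin.snocEquiv fun _ => G) (b, a))).prod = (List.ofFn a).prod * b :=
      List.prod_ofFn_snoc id a b
    have hprod' (a : Fin n → G) (b : G) :
        (List.ofFn fun k => e ((Fin.snocEquiv fun _ => G) (b, a) k) x).prod =
          (List.ofFn fun k => e (a k) x).prod * e b x :=
      List.prod_ofFn_snoc (fun c => e c x) a b
    rw [sweedlerPow_succ_e, ← (Fin.snocEquiv fun _ => G).sum_comp, Fintype.sum_prod_type_right]
    simp only [ih, Finset.sum_mul]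
    rw [Finset.sum_comm]
    refine Finset.sum_congr rfl fun a _ => ?_
    simp only [hprod, hprod']
    rw [Finset.sum_eq_single (List.ofFn a).prod,
      Finset.sum_eq_single ((List.ofFn a).prod⁻¹ * g)]
    · simp
    · intro b _ hb
      rw [if_neg]
      simpa [eq_inv_mul_iff_mul_eq] using hb
    · simp
    · intro b _ hb
      rw [if_neg (Ne.symm hb), zero_mul]
    · simp

/-- The exponent must be positive: the zeroth power is 1, not e_a ⊗ 1. -/
theorem e_pow_of_commute {a g : G} (h : Commute a g) {k : ℕ} (hk : 0 < k) :
    (e a g) ^ k = e a (g ^ k) := by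
  induction k, hk using Nat.le_induction with
  | base => simp
  | succ k _ ih =>
    rw [pow_succ, ih, e_mul_e, ← pow_succ, if_pos]
    rw [(h.pow_right k).symm.eq, mul_inv_cancel_right]

end SweedlerPowers

/-! ### Integral sums of traces of powers -/

section TracesOfPowers

variable {V : Type*} [AddCommGroup V] [Module ℂ V] [FiniteDimensional ℂ V]

theorem exists_int_trace_of_isIdempotentElem {p : Module.End ℂ V} (hp : IsIdempotentElem p) :
    ∃ k : ℤ, LinearMap.trace ℂ V p = k :=
  ⟨Module.finrank ℂ (LinearMap.range p), by
    rw [LinearMap.IsProj.trace (LinearMap.isProj_range_iff_isIdempotentElem p |>.2 hp)]; simp⟩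

/-- If `A ^ (e + 1) = A`, then `A + A ^ 2 + ⋯ + A ^ e` is `e` times an idempotent. -/
theorem exists_int_trace_sum_pow {A : Module.End ℂ V} {e : ℕ} (he : 0 < e)
    (hA : A ^ (e + 1) = A) :
    ∃ k : ℤ, ∑ j ∈ Finset.Icc 1 e, LinearMap.trace ℂ V (A ^ j) = k := by
  set S := ∑ j ∈ Finset.Icc 1 e, A ^ j with hS
  have hAS : A * S = S := by
    have h1 : S = ∑ j ∈ Finset.range e, A ^ (j + 1) := by
      rw [hS, Finset.range_eq_Ico, Finset.sum_Ico_add' (fun j => A ^ j) 0 e 1]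
      rfl
    -- Splitting off either end of A + ⋯ + A^(e+1) removes a term equal to A, so the remaining sums
    -- S and A * S agree.
    have h2 := Finset.sum_range_succ' (fun j => A ^ (j + 1)) e
    have h3 := Finset.sum_range_succ (fun j => A ^ (j + 1)) e
    rw [h2, hA] at h3
    conv_lhs => rw [h1, Finset.mul_sum]
    simp only [← pow_succ']
    rw [h1]
    simpa using h3
  have hpS (j : ℕ) : A ^ j * S = S := by
    induction j with
    | zero => simp
    | succ j ih => rw [pow_succ, mul_assoc, hAS, ih]
  have hSS : S * S = (e : ℂ) • S := by
    have h : S * S = ∑ j ∈ Finset.Icc 1 e, A ^ j * S := Finset.sum_mul ..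
    rw [h, Nat.cast_smul_eq_nsmul]
    simp [hpS]
  have he' : (e : ℂ) ≠ 0 := by exact_mod_cast he.ne'
  have hid : IsIdempotentElem ((e : ℂ)⁻¹ • S) := by
    rw [IsIdempotentElem, smul_mul_smul_comm, hSS, smul_smul, mul_assoc, inv_mul_cancel₀ he',
      mul_one]
  obtain ⟨k, hk⟩ := exists_int_trace_of_isIdempotentElem hid
  refine ⟨e * k, ?_⟩
  rw [← map_sum, ← hS]
  rw [map_smul, smul_eq_mul, inv_mul_eq_iff_eq_mul₀ he'] at hk
  simpa using hk

/-- The sieve that reduces sums over m coprime to e to sums over multiples of d, for d dividing e.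
-/
theorem sum_moebius_divisors_gcd {m e : ℕ} (he : 0 < e) :
    ∑ d ∈ e.divisors with d ∣ m, ArithmeticFunction.moebius d =
      if m.Coprime e then 1 else 0 := by
  have h := congrArg (fun f => f (m.gcd e)) ArithmeticFunction.moebius_mul_coe_zeta
  simp only [ArithmeticFunction.coe_mul_zeta_apply, ArithmeticFunction.one_apply] at h
  simp only [Nat.coprime_iff_gcd_eq_one, ← h]
  refine Finset.sum_congr ?_ fun _ _ => rfl
  ext d
  simp [Nat.dvd_gcd_iff, he.ne', and_comm]

/-- The traces of the powers `A ^ m` with `m` coprime to `e` have an integral sum. -/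
theorem exists_int_trace_sum_pow_coprime {A : Module.End ℂ V} {e : ℕ} (he : 0 < e)
    (hA : A ^ (e + 1) = A) :
    ∃ k : ℤ, ∑ m ∈ Finset.Icc 1 e with m.Coprime e, LinearMap.trace ℂ V (A ^ m) = k := by
  have key (d : ℕ) (hd : d ∈ e.divisors) :
      ∃ k : ℤ, ∑ m ∈ Finset.Icc 1 e with d ∣ m, LinearMap.trace ℂ V (A ^ m) = k := by
    obtain ⟨⟨c, rfl⟩, -⟩ := Nat.mem_divisors.1 hd
    have hd0 : 0 < d := Nat.pos_of_mul_pos_right he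
    have hc0 : 0 < c := Nat.pos_of_mul_pos_left he
    have hB : (A ^ d) ^ (c + 1) = A ^ d := by
      obtain ⟨d, rfl⟩ := Nat.exists_eq_succ_of_ne_zero hd0.ne'
      rw [← pow_mul, show d.succ * (c + 1) = (d.succ * c + 1) + d by
        rw [Nat.succ_eq_add_one]; ring, pow_add, hA, ← pow_succ']
    obtain ⟨k, hk⟩ := exists_int_trace_sum_pow hc0 hB
    refine ⟨k, hk ▸ ?_⟩
    symm
    refine Finset.sum_bij (fun j _ => d * j) ?_ ?_ ?_ ?_
    · intro j hj
      rw [Finset.mem_Icc] at hj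
      simp only [Finset.mem_filter, Finset.mem_Icc, dvd_mul_right, and_true]
      exact ⟨Nat.mul_pos hd0 hj.1, Nat.mul_le_mul_left d hj.2⟩
    · intro i _ j _ h
      exact Nat.eq_of_mul_eq_mul_left hd0 h
    · intro m hm
      simp only [Finset.mem_filter, Finset.mem_Icc] at hm
      obtain ⟨⟨h1, h2⟩, j, rfl⟩ := hm
      exact ⟨j, Finset.mem_Icc.2 ⟨Nat.pos_of_mul_pos_left h1, Nat.le_of_mul_le_mul_left h2 hd0⟩, rfl⟩
    · intro j _
      rw [pow_mul]
  choose! K hK using key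
  refine ⟨∑ d ∈ e.divisors, ArithmeticFunction.moebius d * K d, ?_⟩
  push_cast
  have h1 : ∑ m ∈ Finset.Icc 1 e with m.Coprime e, LinearMap.trace ℂ V (A ^ m) =
      ∑ m ∈ Finset.Icc 1 e, ∑ d ∈ e.divisors,
        if d ∣ m then (ArithmeticFunction.moebius d : ℂ) * LinearMap.trace ℂ V (A ^ m) else 0 := by
    rw [Finset.sum_filter]
    refine Finset.sum_congr rfl fun m _ => ?_
    rw [← Finset.sum_filter, ← Finset.sum_mul, ← Int.cast_sum,
      sum_moebius_divisors_gcd he]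
    split_ifs <;> simp
  rw [h1, Finset.sum_comm]
  refine Finset.sum_congr rfl fun d hd => ?_
  rw [← hK d hd, Finset.mul_sum, Finset.sum_filter]

end TracesOfPowers

/-! ### Rationality of the indicators -/

section Rationality

open DrinfeldDouble

variable {G : Type*} [Group G] [Fintype G] [DecidableEq G]

/-- The number of `y` with `y ^ n = (a * y) ^ n = g`. -/
def commonRootCount (n : ℕ) (a g : G) : ℕ :=
  (Finset.univ.filter fun y : G => y ^ n = g ∧ (a * y) ^ n = g).card

theorem commute_of_commonRoot {H : Type*} [Group H] {n : ℕ} {a g y : H} (h1 : y ^ n = g) (h2 : (a * y) ^ n = g) :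
    Commute a g := by
  have h3 : Commute (a * y) g := h2 ▸ Commute.self_pow _ _
  have h4 : Commute y g := h1 ▸ Commute.self_pow _ _
  simpa using h3.mul_left h4.inv_left

variable (V : Type*) [AddCommGroup V] [Module ℂ V] [Module (DrinfeldDouble G) V]
    [IsScalarTower ℂ (DrinfeldDouble G) V]

/-- With y = x⁻¹, the condition (ax⁻¹)ⁿxⁿ = 1 of `sweedlerPow_e` reads (ay)ⁿ = yⁿ; the sum is
grouped by this common value g. -/
theorem fsIndicator_integral_eq_sum (n : ℕ) :
    fsIndicator (integral G) n V = (Fintype.card G : ℂ)⁻¹ *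
      ∑ a : G, ∑ g : G, commonRootCount n a g *
        moduleCharacter (DrinfeldDouble G) V (e a g⁻¹) := by
  have h1 : sweedlerPow (DrinfeldDouble G) n (integral G) = (Fintype.card G : ℂ)⁻¹ •
      ∑ a : G, ∑ g : G, (commonRootCount n a g : ℂ) • e a g⁻¹ := by
    rw [integral, map_smul, map_sum]
    congr 1
    simp only [sweedlerPow_e]
    rw [Finset.sum_comm]
    refine Finset.sum_congr rfl fun a _ => ?_
    rw [← Equiv.sum_comp (Equiv.inv G)]
    simp only [Equiv.inv_apply, inv_inv, inv_pow, mul_inv_eq_one]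
    have h2 (g : G) : (commonRootCount n a g : ℂ) • e a g⁻¹ =
        ∑ y : G, if y ^ n = g ∧ (a * y) ^ n = g then e a g⁻¹ else 0 := by
      rw [← Finset.sum_filter, Finset.sum_const, commonRootCount, Nat.cast_smul_eq_nsmul]
    simp only [h2]
    rw [Finset.sum_comm]
    refine Finset.sum_congr rfl fun y _ => ?_
    rw [Finset.sum_eq_single (y ^ n)]
    · simp
    · intro b _ hb
      rw [if_neg fun h => hb h.1.symm]
    · simp
  rw [fsIndicator, h1]
  simp [map_sum]

variable [FiniteDimensional ℂ V]

theorem exists_rat_fsIndicator (n : ℕ)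
    (hG : ∀ (a g : G) (m : ℕ), m.Coprime (Fintype.card G) →
      commonRootCount n a (g ^ m) = commonRootCount n a g) :
    ∃ q : ℚ, fsIndicator (integral G) n V = q := by
  set N := Fintype.card G with hN
  have hN0 : 0 < N := Fintype.card_pos
  set U := (Finset.Icc 1 N).filter fun m => m.Coprime N with hU
  have hU0 : (U.card : ℂ) ≠ 0 := by
    rw [Nat.cast_ne_zero]
    exact Finset.card_ne_zero_of_mem (a := 1) (by simp [hU]; omega)
  set χ := moduleCharacter (DrinfeldDouble G) V with hχ
  -- If a and g commute, the summands are traces of powers of a single operator; otherwise there are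
  -- no common roots.
  have hint (a g : G) : ∃ k : ℤ, (commonRootCount n a g : ℂ) *
      ∑ m ∈ U, χ (e a (g ^ m)⁻¹) = k := by
    by_cases h : Commute a g
    · set A : Module.End ℂ V := Algebra.lsmul ℂ ℂ V (e a g⁻¹) with hA
      have hAm {m : ℕ} (hm : 0 < m) : A ^ m = Algebra.lsmul ℂ ℂ V (e a (g ^ m)⁻¹) := by
        rw [hA, ← map_pow, e_pow_of_commute h.inv_right hm, inv_pow]
      have hA1 : A ^ (N + 1) = A := by
        rw [hAm N.succ_pos, pow_succ, pow_card_eq_one, one_mul]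
      obtain ⟨k, hk⟩ := exists_int_trace_sum_pow_coprime hN0 hA1
      refine ⟨commonRootCount n a g * k, ?_⟩
      push_cast
      rw [← hk]
      congr 1
      refine Finset.sum_congr rfl fun m hm => ?_
      rw [hAm]
      · rfl
      · simp at hm; omega
    · refine ⟨0, ?_⟩
      have : commonRootCount n a g = 0 := by
        rw [commonRootCount, Finset.card_eq_zero, Finset.filter_eq_empty_iff]
        exact fun y _ hy => h (commute_of_commonRoot hy.1 hy.2)
      simp [this]
  choose K hK using hint
  have hsum (a : G) : ∑ g : G, commonRootCount n a g * χ (e a g⁻¹) =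
      (U.card : ℂ)⁻¹ * ∑ g : G, (K a g : ℂ) := by
    rw [eq_inv_mul_iff_mul_eq₀ hU0, ← nsmul_eq_mul, ← Finset.sum_const]
    simp only [← hK, Finset.mul_sum]
    rw [Finset.sum_comm]
    rw [Finset.sum_comm]
    conv_rhs => rw [Finset.sum_comm]
    refine Finset.sum_congr rfl fun m hm => ?_
    have hm' : m.Coprime N := (Finset.mem_filter.1 hm).2
    have hm'' : (Nat.card G).Coprime m := by
      rw [Nat.card_eq_fintype_card]; exact hm'.symm
    -- For m prime to |G| the map g ↦ gᵐ permutes G and, by `hG`, preserves the counts.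
    rw [← (powCoprime hm'').sum_comp]
    refine Finset.sum_congr rfl fun g _ => ?_
    rw [powCoprime_apply, hG a g m hm']
  refine ⟨(N : ℚ)⁻¹ * ∑ a : G, (U.card : ℚ)⁻¹ * ∑ g : G, (K a g : ℚ), ?_⟩
  rw [fsIndicator_integral_eq_sum]
  push_cast
  simp only [← hN, ← hχ, hsum]

end Rationality

/-! ### Tensor powers of matrices and cyclic shifts -/

section TensorPowers

variable {ι : Type*} {R : Type*} [CommRing R]

/-- The matrix of `A₀ ⊗ ⋯ ⊗ Aₙ₋₁`. -/
def tensorMatrix {n : ℕ} (A : Fin n → Matrix ι ι R) : Matrix (Fin n → ι) (Fin n → ι) R :=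
  Matrix.of fun I J => ∏ k, A k (I k) (J k)

theorem tensorMatrix_mul [Fintype ι] {n : ℕ} (A B : Fin n → Matrix ι ι R) :
    tensorMatrix A * tensorMatrix B = tensorMatrix fun k => A k * B k := by
  ext I J
  simp only [tensorMatrix, Matrix.mul_apply, Matrix.of_apply, ← Finset.prod_mul_distrib]
  rw [Finset.prod_univ_sum, Fintype.piFinset_univ]

theorem tensorMatrix_eq_zero {n : ℕ} (A : Fin n → Matrix ι ι R) {k : Fin n} (hk : A k = 0) :
    tensorMatrix A = 0 := by
  ext I J
  exact Finset.prod_eq_zero (Finset.mem_univ k) (by simp [hk])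

variable [Fintype ι] [DecidableEq ι]

/-- The matrix of the permutation of the tensor factors by `σ`. -/
def factorPermMatrix {n : ℕ} (ι : Type*) [DecidableEq ι] (R : Type*) [CommRing R]
    (σ : Equiv.Perm (Fin n)) : Matrix (Fin n → ι) (Fin n → ι) R :=
  Matrix.of fun I J => if J = fun k => I (σ k) then 1 else 0

theorem factorPermMatrix_mul_apply {n : ℕ} (σ : Equiv.Perm (Fin n))
    (M : Matrix (Fin n → ι) (Fin n → ι) R) (I J : Fin n → ι) :
    (factorPermMatrix ι R σ * M) I J = M (fun k => I (σ k)) J := by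
  simp [factorPermMatrix, Matrix.mul_apply]

theorem factorPermMatrix_mul_tensorMatrix {n : ℕ} (σ : Equiv.Perm (Fin n))
    (A : Fin n → Matrix ι ι R) :
    factorPermMatrix ι R σ * tensorMatrix (fun k => A (σ k)) =
      tensorMatrix A * factorPermMatrix ι R σ := by
  ext I J
  rw [factorPermMatrix_mul_apply]
  simp only [Matrix.mul_apply, factorPermMatrix, Matrix.of_apply, tensorMatrix]
  rw [Finset.sum_eq_single fun k => J (σ.symm k)]
  · simp only [Equiv.symm_apply_apply, if_true, mul_one]
    rw [← Equiv.prod_comp σ (fun k => A k (I k) (J (σ.symm k)))]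
    simp
  · intro K _ hK
    rw [if_neg, mul_zero]
    rintro rfl
    simp at hK
  · simp

theorem factorPermMatrix_pow_apply {n : ℕ} (σ : Equiv.Perm (Fin n)) (j : ℕ) (I J : Fin n → ι) :
    (factorPermMatrix ι R σ ^ j) I J = if J = fun k => I ((σ ^ j) k) then 1 else 0 := by
  induction j generalizing I with
  | zero => simp [Matrix.one_apply, eq_comm]
  | succ j ih =>
    rw [pow_succ', factorPermMatrix_mul_apply, ih]
    simp [pow_succ']

theorem finRotate_pow_self (n : ℕ) : finRotate n ^ n = 1 := by
  rcases n with _ | _ | n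
  · rfl
  · exact Equiv.ext fun k => Fin.ext (by omega)
  · have h := (isCycle_finRotate (n := n)).orderOf
    rw [support_finRotate, Finset.card_univ, Fintype.card_fin] at h
    exact orderOf_dvd_iff_pow_eq_one.1 h.dvd

theorem factorPermMatrix_pow_eq_one {n : ℕ} {σ : Equiv.Perm (Fin n)} {j : ℕ} (h : σ ^ j = 1) :
    factorPermMatrix ι R σ ^ j = 1 := by
  ext I J
  rw [factorPermMatrix_pow_apply, h]
  simp [Matrix.one_apply, eq_comm]

/-- The entries of a product of matrices as sums over paths. -/
theorem prod_ofFn_apply {n : ℕ} (A : Fin n → Matrix ι ι R) (i j : ι) :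
    (List.ofFn A).prod i j = ∑ I : Fin n → ι,
      (∏ k, A k ((Fin.cons i I : Fin (n + 1) → ι) k.castSucc) (I k)) *
        if (Fin.cons i I : Fin (n + 1) → ι) (Fin.last n) = j then 1 else 0 := by
  induction n generalizing i with
  | zero => simp [Matrix.one_apply]
  | succ n ih =>
    rw [List.ofFn_succ, List.prod_cons, Matrix.mul_apply,
      ← (Fin.consEquiv fun _ => ι).sum_comp, Fintype.sum_prod_type]
    refine Finset.sum_congr rfl fun l _ => ?_
    rw [ih, Finset.mul_sum]
    refine Finset.sum_congr rfl fun I _ => ?_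
    rw [Fin.prod_univ_succ]
    simp only [Fin.consEquiv_apply, Fin.cons_succ, Fin.cons_zero, ← Fin.succ_last,
      Fin.castSucc_succ, Fin.castSucc_zero, mul_assoc]

/-- Both sides are sums over closed paths of length n, weighted by the entries of the A k. For n = 0
the left side is 1 and the right side is the size of ι. -/
theorem trace_rotation_mul_tensorMatrix {n : ℕ} (hn : 0 < n) (A : Fin n → Matrix ι ι R) :
    (factorPermMatrix ι R (finRotate n).symm * tensorMatrix A).trace =
      (List.ofFn A).prod.trace := by
  obtain ⟨n, rfl⟩ := Nat.exists_eq_succ_of_ne_zero hn.ne'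
  have hcons (i : ι) (I : Fin (n + 1) → ι) (k : Fin (n + 1)) (hi : I (Fin.last n) = i) :
      (Fin.cons i I : Fin (n + 2) → ι) k.castSucc = I ((finRotate (n + 1)).symm k) := by
    obtain ⟨l, rfl⟩ := (finRotate (n + 1)).surjective k
    rw [Equiv.symm_apply_apply]
    induction l using Fin.lastCases with
    | last => rw [finRotate_last]; exact hi.symm
    | cast l =>
      have : finRotate (n + 1) l.castSucc = l.succ := by
        rw [finRotate_apply, Fin.coeSucc_eq_succ]
      rw [this, Fin.castSucc_succ, Fin.cons_succ]
  simp only [Matrix.trace, Matrix.diag_apply, factorPermMatrix_mul_apply, prod_ofFn_apply]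
  rw [Finset.sum_comm]
  refine Finset.sum_congr rfl fun I _ => ?_
  rw [Finset.sum_eq_single (I (Fin.last n))]
  · rw [← Fin.succ_last, Fin.cons_succ, if_pos rfl, mul_one]
    simp only [tensorMatrix, Matrix.of_apply]
    exact Finset.prod_congr rfl fun k _ => by rw [hcons _ I k rfl]
  · intro i _ hi
    rw [← Fin.succ_last, Fin.cons_succ, if_neg (Ne.symm hi), mul_zero]
  · simp

/-- The trace of an operator `A` with `A ^ (n + 1) = A` is an algebraic integer. -/
theorem isIntegral_trace_of_pow_succ_eq_self {A : Matrix ι ι ℂ} {n : ℕ} (hn : 0 < n)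
    (hA : A ^ (n + 1) = A) : IsIntegral ℤ A.trace := by
  rw [Matrix.trace_eq_sum_roots_charpoly]
  refine IsIntegral.multiset_sum fun r hr => ?_
  have hr' : r ∈ spectrum ℂ A :=
    Matrix.mem_spectrum_iff_isRoot_charpoly.2 (Polynomial.isRoot_of_mem_roots hr)
  have h := spectrum.subset_polynomial_aeval A (Polynomial.X ^ (n + 1) - Polynomial.X)
    ⟨r, hr', rfl⟩
  simp only [map_sub, map_pow, Polynomial.aeval_X, hA, sub_self] at h
  have : Nonempty ι := by
    by_contra hι
    rw [not_nonempty_iff] at hι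
    simp [Subsingleton.elim A 0, spectrum.of_subsingleton] at hr'
  rw [spectrum.zero_eq, Set.mem_singleton_iff] at h
  refine ⟨Polynomial.X ^ (n + 1) - Polynomial.X, ?_, ?_⟩
  · exact Polynomial.monic_X_pow_sub (by rw [Polynomial.degree_X]; exact_mod_cast Nat.lt_succ_of_le hn)
  · simpa using h

end TensorPowers

/-! ### Algebraic integrality, and the criterion for FSZ_n -/

section Integrality

open DrinfeldDouble

variable {G : Type*} [Group G] [Fintype G] [DecidableEq G] {ι : Type*} [Fintype ι] [DecidableEq ι]

/-- The action of the `n`-fold coproduct of `e_1 ⊗ x` on the `n`-th tensor power of `ρ`. -/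
noncomputable def tensorAction (ρ : DrinfeldDouble G →ₐ[ℂ] Matrix ι ι ℂ) (n : ℕ) (x : G) :
    Matrix (Fin n → ι) (Fin n → ι) ℂ :=
  ∑ a : Fin n → G, if (List.ofFn a).prod = 1 then tensorMatrix fun k => ρ (e (a k) x) else 0

theorem List.prod_ofFn_conj {H : Type*} [Group H] {n : ℕ} (a : Fin n → H) (x : H) :
    (List.ofFn fun k => x * a k * x⁻¹).prod = x * (List.ofFn a).prod * x⁻¹ := by
  have h := map_list_prod (MulAut.conj x) (List.ofFn a)
  rw [List.map_ofFn] at h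
  simpa [Function.comp_def] using h.symm

/-- A tuple a pairs only with its x⁻¹-conjugate, and conjugation preserves the condition that the
product be 1. Hence the average over G is idempotent. -/
theorem tensorAction_mul (ρ : DrinfeldDouble G →ₐ[ℂ] Matrix ι ι ℂ) (n : ℕ) (x y : G) :
    tensorAction ρ n x * tensorAction ρ n y = tensorAction ρ n (x * y) := by
  simp only [tensorAction, Finset.sum_mul_sum]
  refine Finset.sum_congr rfl fun a _ => ?_
  rw [Finset.sum_eq_single fun k => x⁻¹ * a k * x]
  · have h := List.prod_ofFn_conj a x⁻¹
    rw [inv_inv] at h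
    have h1 : x⁻¹ * (List.ofFn a).prod * x = 1 ↔ (List.ofFn a).prod = 1 := by
      simpa using conj_eq_one_iff (a := x⁻¹) (b := (List.ofFn a).prod)
    rw [h]
    simp only [h1]
    split_ifs
    · rw [tensorMatrix_mul]
      congr 1
      ext1 k
      rw [← map_mul, e_mul_e, if_pos (by group)]
    · simp
  · intro b _ hb
    split_ifs
    · obtain ⟨k, hk⟩ := Function.ne_iff.1 hb
      rw [tensorMatrix_mul]
      refine tensorMatrix_eq_zero _ (k := k) ?_
      rw [← map_mul, e_mul_e, if_neg, map_zero]
      intro h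
      apply hk
      rw [h]
      group
    all_goals simp
  · simp

/-- Rotation conjugates the product. This is why the cyclic shift commutes with `tensorAction`. -/
theorem List.prod_ofFn_rotate_eq_one_iff {H : Type*} [Group H] {n : ℕ} (a : Fin n → H) :
    (List.ofFn fun k => a (finRotate n k)).prod = 1 ↔ (List.ofFn a).prod = 1 := by
  rcases n with _ | n
  · simp
  · have h : (List.ofFn fun k => a (finRotate (n + 1) k)) =
        (List.ofFn fun k : Fin n => a k.succ) ++ [a 0] := by
      rw [List.ofFn_succ', List.concat_eq_append, finRotate_last]
      congr 2
      ext1 k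
      rw [finRotate_apply, Fin.coeSucc_eq_succ]
    rw [h, List.ofFn_succ, List.prod_append, List.prod_singleton, List.prod_cons]
    exact mul_eq_one_iff_eq_inv.trans
      (eq_inv_iff_mul_eq_one.trans (by rw [mul_eq_one_comm]))

theorem factorPermMatrix_commute_tensorAction (ρ : DrinfeldDouble G →ₐ[ℂ] Matrix ι ι ℂ) (n : ℕ)
    (x : G) :
    Commute (factorPermMatrix ι ℂ (finRotate n).symm) (tensorAction ρ n x) := by
  rw [commute_iff_eq, tensorAction, Finset.mul_sum, Finset.sum_mul,
    ← Equiv.sum_comp ((finRotate n).arrowCongr (Equiv.refl G))]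
  refine Finset.sum_congr rfl fun a _ => ?_
  have h : (List.ofFn ((finRotate n).arrowCongr (Equiv.refl G) a)).prod = 1 ↔
      (List.ofFn a).prod = 1 := by
    rw [← List.prod_ofFn_rotate_eq_one_iff]
    simp only [Equiv.arrowCongr_apply, Function.comp_apply, Equiv.symm_apply_apply,
      Equiv.refl_apply]
  simp only [h]
  split_ifs
  · rw [← factorPermMatrix_mul_tensorMatrix]
    rfl
  · simp

/-- Frobenius-Schur indicators are algebraic integers. -/
theorem isIntegral_fsIndicator (V : Type*) [AddCommGroup V] [Module ℂ V]
    [Module (DrinfeldDouble G) V] [IsScalarTower ℂ (DrinfeldDouble G) V] [FiniteDimensional ℂ V]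
    {n : ℕ} (hn : 0 < n) : IsIntegral ℤ (fsIndicator (integral G) n V) := by
  classical
  let b := Module.finBasis ℂ V
  let ρ : DrinfeldDouble G →ₐ[ℂ] Matrix _ _ ℂ :=
    (LinearMap.toMatrixAlgEquiv b).toAlgHom.comp (Algebra.lsmul ℂ ℂ V)
  have hρ (d : DrinfeldDouble G) : moduleCharacter (DrinfeldDouble G) V d = (ρ d).trace :=
    LinearMap.trace_eq_matrix_trace ℂ b _
  set Q := (Fintype.card G : ℂ)⁻¹ • ∑ x : G, tensorAction ρ n x with hQ
  set P := factorPermMatrix (Fin (Module.finrank ℂ V)) ℂ (finRotate n).symm with hP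
  have hN : (Fintype.card G : ℂ) ≠ 0 := by simp
  have hQQ : IsIdempotentElem Q := by
    rw [IsIdempotentElem, hQ, smul_mul_smul_comm, Finset.sum_mul_sum]
    have h (x : G) : ∑ y : G, tensorAction ρ n x * tensorAction ρ n y =
        ∑ y : G, tensorAction ρ n y := by
      simp only [tensorAction_mul]
      exact Equiv.sum_comp (Equiv.mulLeft x) (tensorAction ρ n)
    simp only [h, Finset.sum_const, Finset.card_univ]
    rw [← Nat.cast_smul_eq_nsmul ℂ, smul_smul, mul_assoc, inv_mul_cancel₀ hN, mul_one]
  have hPQ : Commute P Q :=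
    (Commute.sum_right _ _ _ fun x _ =>
      factorPermMatrix_commute_tensorAction ρ n x).smul_right _
  have hPn : P ^ n = 1 := factorPermMatrix_pow_eq_one (by
    have := finRotate_pow_self n
    rw [← Equiv.Perm.inv_def, inv_pow, this, inv_one])
  have hE : (P * Q) ^ (n + 1) = P * Q := by
    rw [hPQ.mul_pow, hQQ.pow_succ_eq, pow_succ, hPn, one_mul]
  have htr : fsIndicator (integral G) n V = (P * Q).trace := by
    have h (x : G) : moduleCharacter (DrinfeldDouble G) V
        (sweedlerPow (DrinfeldDouble G) n (e 1 x)) = (P * tensorAction ρ n x).trace := by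
      rw [sweedlerPow_e_eq_sum_tuples, map_sum, tensorAction, Finset.mul_sum, Matrix.trace_sum]
      refine Finset.sum_congr rfl fun a _ => ?_
      split_ifs
      · rw [hP, trace_rotation_mul_tensorMatrix hn, hρ, map_list_prod, List.map_ofFn]
        rfl
      · simp
    rw [fsIndicator, integral, map_smul, map_smul, map_sum, map_sum, hQ, mul_smul_comm,
      Matrix.trace_smul, Finset.mul_sum, Matrix.trace_sum]
    simp only [h]
  rw [htr]
  exact isIntegral_trace_of_pow_succ_eq_self hn hE

/-- A group is `FSZ_n` if the numbers of common `n`-th roots `y`, `a * y` of `g` only depend on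
`a` and the cyclic group generated by `g`. -/
theorem isFSZn_of_commonRootCount_pow_eq {n : ℕ} (hn : 0 < n)
    (hG : ∀ (a g : G) (m : ℕ), m.Coprime (Fintype.card G) →
      commonRootCount n a (g ^ m) = commonRootCount n a g) : IsFSZn G n := by
  intro V _ _ _ _ _
  have := finiteDimensional_of_isSimpleModule (G := G) V
  obtain ⟨q, hq⟩ := exists_rat_fsIndicator V n hG
  have h := isIntegral_fsIndicator (G := G) V hn
  rw [hq, show (q : ℂ) = algebraMap ℚ ℂ q from rfl,
    isIntegral_algebraMap_iff (algebraMap ℚ ℂ).injective, IsIntegrallyClosed.isIntegral_iff] at h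
  obtain ⟨k, hk⟩ := h
  exact ⟨k, by rw [hq, ← hk]; simp⟩

end Integrality

/-! ### Common transversals from Hall's theorem -/

section CommonTransversal

/-- Two partitions of a finite set into blocks of the same size have a common transversal. -/
theorem exists_common_transversal {α P Q : Type*} [DecidableEq α] [DecidableEq P] [DecidableEq Q]
    (X : Finset α) (p : α → P) (q : α → Q) {c : ℕ} (hc : 0 < c)
    (hp : ∀ x ∈ X, (X.filter fun y => p y = p x).card = c)
    (hq : ∀ x ∈ X, (X.filter fun y => q y = q x).card = c) :
    ∃ T ⊆ X, (∀ x ∈ X, ∃! t, t ∈ T ∧ p t = p x) ∧ ∀ x ∈ X, ∃! t, t ∈ T ∧ q t = q x := by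
  have hpc (S : Finset P) (hS : S ⊆ X.image p) : (X.filter fun x => p x ∈ S).card = S.card * c := by
    rw [Finset.card_eq_sum_card_fiberwise (f := p) (t := S) (fun x hx => by simp_all)]
    refine Finset.sum_const_nat fun a ha => ?_
    obtain ⟨x, hx, rfl⟩ := Finset.mem_image.1 (hS ha)
    rw [← hp x hx, Finset.filter_filter]
    congr 1
    ext y
    simp only [Finset.mem_filter]
    exact ⟨fun h => ⟨h.1, h.2.2⟩, fun h => ⟨h.1, by rw [h.2]; exact ha, h.2⟩⟩
  have hqc (S : Finset Q) (hS : S ⊆ X.image q) : (X.filter fun x => q x ∈ S).card = S.card * c := by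
    rw [Finset.card_eq_sum_card_fiberwise (f := q) (t := S) (fun x hx => by simp_all)]
    refine Finset.sum_const_nat fun a ha => ?_
    obtain ⟨x, hx, rfl⟩ := Finset.mem_image.1 (hS ha)
    rw [← hq x hx, Finset.filter_filter]
    congr 1
    ext y
    simp only [Finset.mem_filter]
    exact ⟨fun h => ⟨h.1, h.2.2⟩, fun h => ⟨h.1, by rw [h.2]; exact ha, h.2⟩⟩
  let t : X.image p → Finset Q := fun a => (X.filter fun x => p x = a).image q
  -- Hall's condition: the p-blocks in s contain |s| * c points, all lying in the q-blocks that they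
  -- meet, each of size c.
  obtain ⟨f, hf, hft⟩ := (Finset.all_card_le_biUnion_card_iff_exists_injective t).1 fun s => by
    have h1 := hpc (s.map (Function.Embedding.subtype _)) (by
      intro a ha
      obtain ⟨b, -, rfl⟩ := Finset.mem_map.1 ha
      exact b.2)
    have h2 := hqc (s.biUnion t) (by
      intro a ha
      obtain ⟨b, -, hb⟩ := Finset.mem_biUnion.1 ha
      exact Finset.image_subset_image (Finset.filter_subset _ _) hb)
    refine Nat.le_of_mul_le_mul_right ?_ hc
    rw [← h2, ← Finset.card_map (Function.Embedding.subtype _), ← h1]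
    refine Finset.card_le_card fun x hx => ?_
    simp only [Finset.mem_filter] at hx ⊢
    refine ⟨hx.1, Finset.mem_biUnion.2 ?_⟩
    obtain ⟨b, hb, hbx⟩ := Finset.mem_map.1 hx.2
    exact ⟨b, hb, Finset.mem_image.2 ⟨x, Finset.mem_filter.2 ⟨hx.1, hbx.symm⟩, rfl⟩⟩
  have hw (a : X.image p) : ∃ x ∈ X, p x = a ∧ q x = f a := by
    obtain ⟨x, hx, hxf⟩ := Finset.mem_image.1 (hft a)
    exact ⟨x, (Finset.mem_filter.1 hx).1, (Finset.mem_filter.1 hx).2, hxf⟩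
  choose w hwX hwp hwq using hw
  -- There are equally many p-blocks and q-blocks, so the matching is onto.
  have himage : Finset.univ.image f = X.image q := by
    refine Finset.eq_of_subset_of_card_le ?_ ?_
    · intro b hb
      obtain ⟨a, -, rfl⟩ := Finset.mem_image.1 hb
      exact Finset.mem_image.2 ⟨w a, hwX a, hwq a⟩
    · refine Nat.le_of_mul_le_mul_right ?_ hc
      rw [Finset.card_image_of_injective _ hf, Finset.card_univ, Fintype.card_coe,
        ← hqc _ subset_rfl, ← hpc _ subset_rfl]
      refine Finset.card_le_card fun x hx => ?_
      simp only [Finset.mem_filter] at hx ⊢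
      exact ⟨hx.1, Finset.mem_image_of_mem p hx.1⟩
  refine ⟨Finset.univ.image w, ?_, fun x hx => ?_, fun x hx => ?_⟩
  · intro x hx
    obtain ⟨a, -, rfl⟩ := Finset.mem_image.1 hx
    exact hwX a
  · refine ⟨w ⟨p x, Finset.mem_image_of_mem p hx⟩, ⟨Finset.mem_image_of_mem _ (Finset.mem_univ _),
      hwp _⟩, ?_⟩
    rintro _ ⟨hy, hyp⟩
    obtain ⟨a, -, rfl⟩ := Finset.mem_image.1 hy
    rw [hwp] at hyp
    exact congrArg w (Subtype.ext hyp)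
  · obtain ⟨a, -, ha⟩ := Finset.mem_image.1 (himage ▸ Finset.mem_image_of_mem q hx)
    refine ⟨w a, ⟨Finset.mem_image_of_mem _ (Finset.mem_univ _), (hwq a).trans ha⟩, ?_⟩
    rintro _ ⟨hy, hyq⟩
    obtain ⟨b, -, rfl⟩ := Finset.mem_image.1 hy
    rw [hwq, ← ha] at hyq
    rw [hf hyq]

end CommonTransversal

/-! ### Arithmetic of the exponents -/

section Arithmetic

theorem Nat.exists_eq_mul_primes_dvd_coprime {n : ℕ} (hn : 0 < n) (i : ℕ) :
    ∃ d c : ℕ, n = c * d ∧ (∀ p : ℕ, p.Prime → p ∣ d → p ∣ i) ∧ c.Coprime i := by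
  induction n using Nat.strong_induction_on with
  | _ n ih =>
    by_cases h : n.Coprime i
    · exact ⟨1, n, by simp, fun p hp h1 => absurd (Nat.dvd_one.1 h1) hp.ne_one, h⟩
    · obtain ⟨p, hp, ⟨k, rfl⟩, hpi⟩ := Nat.Prime.not_coprime_iff_dvd.1 h
      have hk : 0 < k := Nat.pos_of_mul_pos_left hn
      obtain ⟨d, c, hdc, hd, hc⟩ := ih k (lt_mul_of_one_lt_left hk hp.one_lt) hk
      refine ⟨p * d, c, by rw [hdc]; ring, fun r hr hrd => ?_, hc⟩
      rcases hr.dvd_mul.1 hrd with h1 | h1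
      · rwa [(Nat.prime_dvd_prime_iff_eq hr hp).1 h1]
      · exact hd r hr h1

/-- Even exponents suffice: if i is even then m is odd and (m - 1) / 2 can be used; if i is odd then
2 is invertible. -/
theorem Nat.exists_one_add_two_mul_modEq {i c m : ℕ} (hi : 0 < i) (hc : c.Coprime i)
    (hm : m.Coprime i) : ∃ u : ℕ, 1 + c * (2 * u) ≡ m [MOD i] := by
  have hinv {k : ℕ} (hk : k.Coprime i) (l : ℕ) : ∃ v, k * v ≡ l [MOD i] := by
    obtain ⟨v, hv⟩ := Nat.exists_mul_mod_eq_of_coprime l hk hi.ne'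
    exact ⟨v, hv.2⟩
  rcases Nat.even_or_odd i with h | h
  · have hmo : Odd m := by
      rw [← Nat.coprime_two_right]
      exact hm.coprime_dvd_right h.two_dvd
    obtain ⟨k, rfl⟩ := hmo
    obtain ⟨v, hv⟩ := hinv hc k
    refine ⟨v, ?_⟩
    have := (hv.mul_left 2).add_left 1
    rwa [show 1 + 2 * (c * v) = 1 + c * (2 * v) by ring, add_comm 1 (2 * k)] at this
  · have h2 : (c * 2).Coprime i := hc.mul_left (Nat.coprime_two_left.2 h)
    obtain ⟨v, hv⟩ := hinv h2 (m + i - 1)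
    refine ⟨v, ?_⟩
    rw [← mul_assoc]
    refine (hv.add_left 1).trans ?_
    rw [show 1 + (m + i - 1) = m + i by omega]
    simp [Nat.ModEq]

theorem Finset.sum_range_mul_eq {M : Type*} [AddCommMonoid M] (f : ℕ → M) (c d : ℕ) :
    ∑ j ∈ Finset.range (c * d), f j =
      ∑ s ∈ Finset.range c, ∑ r ∈ Finset.range d, f (c * r + s) := by
  rw [Finset.sum_comm]
  induction d with
  | zero => simp
  | succ d ih => rw [mul_add_one, Finset.sum_range_add, ih, Finset.sum_range_succ]

end Arithmetic

open Equiv Function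

variable {α : Type*}

/-! ### Periods of roots of a permutation -/

section Periods

theorem Equiv.Perm.minimalPeriod_pos [Finite α] (g : Perm α) (x : α) : 0 < minimalPeriod g x :=
  minimalPeriod_pos_of_mem_periodicPts (g.injective.mem_periodicPts x)

theorem Equiv.Perm.minimalPeriod_apply_of_commute {y g : Perm α} (h : Commute y g) (x : α) :
    minimalPeriod g (y x) = minimalPeriod g x := by
  have key (k : ℕ) : IsPeriodicPt g k (y x) ↔ IsPeriodicPt g k x := by
    rw [IsPeriodicPt, IsPeriodicPt, IsFixedPt, IsFixedPt, Perm.iterate_eq_pow,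
      ← Perm.mul_apply, ← (h.pow_right k).eq, Perm.mul_apply, y.injective.eq_iff]
  refine Nat.dvd_antisymm ?_ ?_
  · exact isPeriodicPt_iff_minimalPeriod_dvd.1 ((key _).2 (isPeriodicPt_minimalPeriod g x))
  · exact isPeriodicPt_iff_minimalPeriod_dvd.1 ((key _).1 (isPeriodicPt_minimalPeriod g (y x)))

theorem Equiv.Perm.minimalPeriod_pow_apply_of_commute {y g : Perm α} (h : Commute y g) (j : ℕ)
    (x : α) : minimalPeriod g ((y ^ j) x) = minimalPeriod g x :=
  minimalPeriod_apply_of_commute (h.pow_left j) x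

/-- If y has period L at x, then g has period i = L / gcd(L, d), which is coprime to d / gcd(L, d).
A prime factor of the latter would divide i by `hd`, so d divides L. -/
theorem Equiv.Perm.minimalPeriod_eq_mul [Finite α] {g y : Perm α} {d : ℕ} (hd0 : d ≠ 0) (hy : y ^ d = g)
    (x : α) (hd : ∀ p : ℕ, p.Prime → p ∣ d → p ∣ minimalPeriod g x) :
    minimalPeriod y x = d * minimalPeriod g x := by
  set i := minimalPeriod g x with hi
  set L := minimalPeriod y x with hL
  have h1 : i = L / L.gcd d := by
    rw [hi, ← hy, Perm.coe_pow, minimalPeriod_iterate_eq_div_gcd hd0]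
  have hL0 : 0 < L := Equiv.Perm.minimalPeriod_pos y x
  obtain ⟨k, hk⟩ := Nat.gcd_dvd_right L d
  have h2 : L.gcd d * i = L := by rw [h1]; exact Nat.mul_div_cancel' (Nat.gcd_dvd_left L d)
  set h := L.gcd d with hh
  have hh0 : 0 < h := Nat.gcd_pos_of_pos_left _ hL0
  have h3 : i.Coprime k := by
    have : h * i.gcd k = h * 1 := by
      rw [← Nat.gcd_mul_left, h2, ← hk, mul_one, hh]
    exact Nat.eq_of_mul_eq_mul_left hh0 this
  have hk1 : k = 1 := by
    by_contra hne
    obtain ⟨p, hp, hpk⟩ := Nat.exists_prime_and_dvd hne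
    have := hd p hp (hk ▸ hpk.mul_left h)
    exact hp.ne_one (Nat.dvd_one.1 (h3 ▸ Nat.dvd_gcd this hpk))
  rw [hk, hk1, mul_one, h2]

end Periods

/-! ### Twisting by powers of g that vary with the cycle -/

section TwistedPowers

/-- The permutation `x ↦ g ^ β(x) x`, for a function `β` that is constant on the cycles of `g`. -/
def Equiv.Perm.twist (g : Perm α) (β : α → ℕ) (hβ : ∀ x, β (g x) = β x) : Perm α :=
  have h (k : ℕ) (x : α) : β ((g ^ k) x) = β x := by
    induction k with
    | zero => rfl
    | succ k ih => rw [pow_succ', Perm.mul_apply, hβ, ih]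
  { toFun := fun x => (g ^ β x) x
    invFun := fun x => (g ^ β x).symm x
    left_inv := fun x => by simp [h]
    right_inv := fun x => by
      have : β ((g ^ β x).symm x) = β x := by
        rw [← h (β x) ((g ^ β x).symm x), Equiv.apply_symm_apply]
      simp [this] }

variable {g : Perm α}

theorem Equiv.Perm.twist_apply (β : α → ℕ) (hβ : ∀ x, β (g x) = β x) (x : α) :
    g.twist β hβ x = (g ^ β x) x := rfl

theorem Equiv.Perm.apply_pow_of_invariant {β : α → ℕ} (hβ : ∀ x, β (g x) = β x) (k : ℕ) (x : α) :
    β ((g ^ k) x) = β x := by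
  induction k with
  | zero => rfl
  | succ k ih => rw [pow_succ', Perm.mul_apply, hβ, ih]

theorem Equiv.Perm.SameCycle.apply_eq_of_invariant [Finite α] {β : α → ℕ} (hβ : ∀ x, β (g x) = β x)
    {x x' : α} (h : g.SameCycle x x') : β x = β x' := by
  obtain ⟨k, -, rfl⟩ := h.exists_pow_eq'
  exact (apply_pow_of_invariant hβ k x).symm

theorem Equiv.Perm.twist_two_mul (γ : α → ℕ) (hγ : ∀ x, γ (g x) = γ x)
    (hγ' : ∀ x, 2 * γ (g x) = 2 * γ x) :
    g.twist (fun x => 2 * γ x) hγ' = g.twist γ hγ ^ 2 := by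
  ext x
  rw [sq, mul_apply, twist_apply, twist_apply, twist_apply, apply_pow_of_invariant hγ,
    ← mul_apply, ← pow_add, two_mul]

/-- Since β is constant on g-cycles, earlier powers of g do not affect later exponents, and they
move past y. -/
theorem Equiv.Perm.mul_twist_pow_apply {y : Perm α} (hy : Commute y g) (β : α → ℕ)
    (hβ : ∀ x, β (g x) = β x) (k : ℕ) (x : α) :
    ((y * g.twist β hβ) ^ k) x = (g ^ ∑ j ∈ Finset.range k, β ((y ^ j) x)) ((y ^ k) x) := by
  induction k with
  | zero => simp
  | succ k ih =>
    have h (l : ℕ) (w : α) : y ((g ^ l) w) = (g ^ l) (y w) := by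
      rw [← mul_apply, (hy.pow_right l).eq, mul_apply]
    rw [pow_succ', mul_apply, ih, mul_apply, twist_apply, apply_pow_of_invariant hβ,
      ← mul_apply (g ^ _), ← pow_add, h, Finset.sum_range_succ, pow_succ', mul_apply y, add_comm]

end TwistedPowers
-- Exponents that suit two roots at once
section RootTwists

theorem Equiv.Perm.mem_orbit_zpowers_iff {y : Perm α} {x w : α} :
    w ∈ MulAction.orbit (Subgroup.zpowers y) x ↔ y.SameCycle x w := by
  constructor
  · rintro ⟨⟨_, k, rfl⟩, rfl⟩
    exact ⟨k, rfl⟩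
  · rintro ⟨k, rfl⟩
    exact ⟨⟨_, k, rfl⟩, rfl⟩

theorem Equiv.Perm.card_filter_orbit_eq [Fintype α] [DecidableEq α] (y : Perm α) (X : Finset α)
    (hX : ∀ x ∈ X, y x ∈ X) {x : α} (hx : x ∈ X) [DecidableEq (Set α)] :
    (X.filter fun w => MulAction.orbit (Subgroup.zpowers y) w =
      MulAction.orbit (Subgroup.zpowers y) x).card = minimalPeriod y x := by
  classical
  have h := MulAction.minimalPeriod_eq_card (a := y) (b := x)
  rw [show (fun w => y • w) = y from rfl] at h
  rw [h, ← Set.toFinset_card]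
  congr 1
  ext w
  simp only [Finset.mem_filter, Set.mem_toFinset, MulAction.orbit_eq_iff, and_iff_right_iff_imp]
  intro hw
  obtain ⟨k, -, rfl⟩ := (Perm.mem_orbit_zpowers_iff.1 hw).exists_pow_eq'
  clear hw
  induction k with
  | zero => exact hx
  | succ k ih => rw [pow_succ', mul_apply]; exact hX _ ih

variable [Finite α] {g : Perm α}

/-- If `T` meets every cycle of `y ^ c` inside `X` exactly once, then exactly `c` of the points
`x, y x, …, y ^ (c * d - 1) x` lie on a `g`-cycle that meets `T`. -/
theorem Equiv.Perm.card_filter_sameCycle_transversal {y : Perm α} {c d : ℕ} (hd0 : d ≠ 0)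
    (hy : y ^ (c * d) = g) {x : α} {T X : Set α}
    (hX : ∀ w ∈ X, y w ∈ X) (hx : x ∈ X)
    (hd : ∀ p : ℕ, p.Prime → p ∣ d → p ∣ minimalPeriod g x)
    (hT : ∀ w ∈ X, ∃! t, t ∈ T ∧ (y ^ c).SameCycle w t)
    [DecidablePred fun w => ∃ t ∈ T, g.SameCycle w t] (u : ℕ) :
    ∑ j ∈ Finset.range (c * d), (if ∃ t ∈ T, g.SameCycle ((y ^ j) x) t then u else 0) = c * u := by
  have hyg : Commute y g := hy ▸ Commute.self_pow y _
  rw [Finset.sum_range_mul_eq, ← smul_eq_mul, ← Finset.card_range c, ← Finset.sum_const,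
    Finset.card_range]
  refine Finset.sum_congr rfl fun s _ => ?_
  set w := (y ^ s) x with hw
  set Y := y ^ c with hY
  have hYd : Y ^ d = g := by rw [hY, ← pow_mul, hy]
  have hwX (s : ℕ) : (y ^ s) x ∈ X := by
    induction s with
    | zero => exact hx
    | succ s ih => rw [pow_succ', mul_apply]; exact hX _ ih
  have hwg : minimalPeriod g w = minimalPeriod g x := minimalPeriod_pow_apply_of_commute hyg s x
  have hL : minimalPeriod Y w = d * minimalPeriod g x := by
    rw [minimalPeriod_eq_mul hd0 hYd w (hwg ▸ hd), hwg]
  have hstep (r : ℕ) : (y ^ (c * r + s)) x = (Y ^ r) w := by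
    rw [hw, ← mul_apply, hY, ← pow_mul, ← pow_add]
  have hgY {v v' : α} (h : g.SameCycle v v') : Y.SameCycle v v' := by
    obtain ⟨k, rfl⟩ := h
    rw [← hYd]
    exact ⟨d * k, by rw [zpow_mul, zpow_natCast]⟩
  obtain ⟨t, ⟨htT, hwt⟩, htu⟩ := hT w (hwX s)
  obtain ⟨k, -, hk⟩ := hwt.exists_pow_eq'
  -- As Y ^ d = g, exponents of Y matter only modulo d up to g-cycles; uniqueness modulo d follows
  -- because d divides the Y-period of w.
  have hr0 : g.SameCycle ((Y ^ (k % d)) w) t := by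
    refine ⟨(k / d : ℕ), ?_⟩
    rw [← hk, ← hYd, zpow_natCast, ← mul_apply, ← pow_mul, ← pow_add, Nat.div_add_mod]
  rw [Finset.sum_eq_single (k % d)]
  · rw [if_pos ⟨t, htT, by rw [hstep]; exact hr0⟩]
  · intro r hr hrk
    rw [if_neg]
    rintro ⟨t', ht', hrt⟩
    rw [hstep] at hrt
    have htt : t' = t := htu t' ⟨ht', Perm.SameCycle.trans ⟨r, by rw [zpow_natCast]⟩ (hgY hrt)⟩
    subst htt
    obtain ⟨l, -, hl⟩ := (hrt.trans hr0.symm).exists_pow_eq'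
    rw [← hYd, ← pow_mul, ← mul_apply, ← pow_add] at hl
    have hmod : d * l + r ≡ k % d [MOD minimalPeriod Y w] := by
      clear_value Y
      rw [← Perm.iterate_eq_pow, ← Perm.iterate_eq_pow, ← iterate_mod_minimalPeriod_eq,
        ← iterate_mod_minimalPeriod_eq (n := k % d)] at hl
      exact (iterate_eq_iterate_iff_of_lt_minimalPeriod (Nat.mod_lt _ (minimalPeriod_pos Y w))
        (Nat.mod_lt _ (minimalPeriod_pos Y w))).1 hl
    rw [hL] at hmod
    have h2 : r % d = k % d % d := by simpa [Nat.ModEq] using hmod.of_mul_right _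
    apply hrk
    rwa [Nat.mod_eq_of_lt (Finset.mem_range.1 hr), Nat.mod_mod] at h2
  · intro h
    exact absurd (Finset.mem_range.2 (Nat.mod_lt _ (Nat.pos_of_ne_zero hd0))) h

/-- Write n = c * d with c prime to i and every prime factor of d dividing i. On the points of
g-period i all cycles of y ^ c and z ^ c have length d * i, so they have a common transversal T.
Taking γ = u on the g-cycles meeting T and 0 elsewhere, both sums equal 2cu, and u solves 1 + 2cu ≡
m. -/
theorem Equiv.Perm.exists_twist_of_period {y z : Perm α} {n i m : ℕ} (hn : 0 < n) (hi : 0 < i)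
    (hm : m.Coprime i) (hy : y ^ n = g) (hz : z ^ n = g) :
    ∃ γ : α → ℕ, (∀ x, γ (g x) = γ x) ∧ ∀ x, minimalPeriod g x = i →
      (1 + ∑ j ∈ Finset.range n, 2 * γ ((y ^ j) x) ≡ m [MOD i]) ∧
      (1 + ∑ j ∈ Finset.range n, 2 * γ ((z ^ j) x) ≡ m [MOD i]) := by
  classical
  have := Fintype.ofFinite α
  obtain ⟨d, c, rfl, hd, hc⟩ := Nat.exists_eq_mul_primes_dvd_coprime hn i
  have hd0 : 0 < d := Nat.pos_of_mul_pos_left hn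
  obtain ⟨u, hu⟩ := Nat.exists_one_add_two_mul_modEq hi hc hm
  set X : Finset α := Finset.univ.filter fun x => minimalPeriod g x = i with hX
  have hmem {x : α} : x ∈ X ↔ minimalPeriod g x = i := by simp [hX]
  have hclosed {w : Perm α} (hw : Commute w g) (x : α) (hx : x ∈ X) : w x ∈ X := by
    rw [hmem] at hx ⊢
    rw [minimalPeriod_apply_of_commute hw, hx]
  have hcomm {w : Perm α} (hw : w ^ (c * d) = g) : Commute w g := hw ▸ Commute.self_pow w _
  have hcard {w : Perm α} (hw : w ^ (c * d) = g) (x : α) (hx : x ∈ X) :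
      (X.filter fun v => MulAction.orbit (Subgroup.zpowers (w ^ c)) v =
        MulAction.orbit (Subgroup.zpowers (w ^ c)) x).card = d * i := by
    rw [card_filter_orbit_eq _ X (hclosed ((hcomm hw).pow_left c)) hx,
      minimalPeriod_eq_mul hd0.ne' (g := g) (by rw [← pow_mul, hw]), hmem.1 hx]
    rwa [hmem.1 hx]
  obtain ⟨T, -, hTy, hTz⟩ := exists_common_transversal X
    (fun x => MulAction.orbit (Subgroup.zpowers (y ^ c)) x)
    (fun x => MulAction.orbit (Subgroup.zpowers (z ^ c)) x) (Nat.mul_pos hd0 hi)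
    (hcard hy) (hcard hz)
  simp only [MulAction.orbit_eq_iff, mem_orbit_zpowers_iff] at hTy hTz
  have hsum {w : Perm α} (hw : w ^ (c * d) = g)
      (hT : ∀ x ∈ X, ∃! t, t ∈ T ∧ (w ^ c).SameCycle x t) (x : α) (hx : x ∈ X) :=
    card_filter_sameCycle_transversal (T := (T : Set α)) (X := (X : Set α)) hd0.ne' hw
      (hclosed (hcomm hw)) hx (by rwa [hmem.1 hx]) hT u
  refine ⟨fun x => if ∃ t ∈ (T : Set α), g.SameCycle x t then u else 0, fun x => ?_,
    fun x hx => ?_⟩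
  · simp only [sameCycle_apply_left]
  · rw [← hmem] at hx
    rw [← Finset.mul_sum, ← Finset.mul_sum, hsum hy hTy x hx, hsum hz hTz x hx]
    rw [mul_left_comm] at hu
    exact ⟨hu, hu⟩

/-- Both y and z preserve g-periods, so the solutions for the separate periods can be glued. -/
theorem Equiv.Perm.exists_twist {y z : Perm α} {n m : ℕ} (hn : 0 < n)
    (hm : m.Coprime (orderOf g)) (hy : y ^ n = g) (hz : z ^ n = g) :
    ∃ γ : α → ℕ, (∀ x, γ (g x) = γ x) ∧ ∀ x,
      (1 + ∑ j ∈ Finset.range n, 2 * γ ((y ^ j) x) ≡ m [MOD minimalPeriod g x]) ∧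
      (1 + ∑ j ∈ Finset.range n, 2 * γ ((z ^ j) x) ≡ m [MOD minimalPeriod g x]) := by
  have h (x : α) := exists_twist_of_period hn (minimalPeriod_pos g x)
    (hm.coprime_dvd_right (by
      rw [← isPeriodicPt_iff_minimalPeriod_dvd, IsPeriodicPt, IsFixedPt, iterate_eq_pow,
        pow_orderOf_eq_one, one_apply])) hy hz
  have h' (i : ℕ) : ∃ γ : α → ℕ, (∀ x, γ (g x) = γ x) ∧ ∀ x, minimalPeriod g x = i →
      (1 + ∑ j ∈ Finset.range n, 2 * γ ((y ^ j) x) ≡ m [MOD i]) ∧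
      (1 + ∑ j ∈ Finset.range n, 2 * γ ((z ^ j) x) ≡ m [MOD i]) := by
    by_cases hi : ∃ x, minimalPeriod g x = i
    · obtain ⟨x, rfl⟩ := hi
      exact h x
    · exact ⟨0, fun _ => rfl, fun x hx => absurd ⟨x, hx⟩ hi⟩
  choose γ hγ hγm using h'
  refine ⟨fun x => γ (minimalPeriod g x) x, fun x => ?_, fun x => ?_⟩
  · simp only [minimalPeriod_apply_of_commute (Commute.refl g), hγ]
  · have hyg : Commute y g := hy ▸ Commute.self_pow y _
    have hzg : Commute z g := hz ▸ Commute.self_pow z _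
    simp only [minimalPeriod_pow_apply_of_commute hyg, minimalPeriod_pow_apply_of_commute hzg]
    exact hγm _ x rfl

end RootTwists

/-! ### Comparing common roots of g and of its powers -/

section CommonRoots

variable {g : Perm α}

theorem Equiv.Perm.mul_twist_pow_eq {y : Perm α} {n m : ℕ} (hy : y ^ n = g) (β : α → ℕ)
    (hβ : ∀ x, β (g x) = β x)
    (h : ∀ x, 1 + ∑ j ∈ Finset.range n, β ((y ^ j) x) ≡ m [MOD minimalPeriod g x]) :
    (y * g.twist β hβ) ^ n = g ^ m := by
  ext x
  have hyg : Commute y g := hy ▸ Commute.self_pow y _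
  rw [mul_twist_pow_apply hyg, hy, ← mul_apply, ← pow_succ, add_comm, ← iterate_eq_pow,
    ← iterate_eq_pow, ← iterate_mod_minimalPeriod_eq, h x, iterate_mod_minimalPeriod_eq]

theorem Equiv.Perm.sameCycle_pow_apply {y y' : Perm α} (hy : Commute y g)
    (h : ∀ x, g.SameCycle (y x) (y' x)) (j : ℕ) (x : α) :
    g.SameCycle ((y ^ j) x) ((y' ^ j) x) := by
  induction j with
  | zero => exact Perm.SameCycle.refl g x
  | succ j ih =>
    rw [pow_succ', pow_succ', mul_apply, mul_apply]
    refine Perm.SameCycle.trans ?_ (h _)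
    obtain ⟨k, hk⟩ := ih
    exact ⟨k, by rw [← hk, ← mul_apply, ← mul_apply y, (hy.zpow_right k).eq, mul_apply]⟩

variable [Finite α]

/-- Whether `y * twist γ` is a common root of `g ^ m` only depends on the action of `y` on the
cycles of `g`, so that `γ` can be chosen as a function of this action. -/
theorem Equiv.Perm.exists_twist_of_key {n m : ℕ} (hn : 0 < n) (hm : m.Coprime (orderOf g))
    (a : Perm α) (κ : α → Quotient (Perm.SameCycle.setoid g)) :
    ∃ γ : α → ℕ, ∃ hγ : ∀ x, γ (g x) = γ x, ∀ y : Perm α, y ^ n = g → (a * y) ^ n = g →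
      (∀ x, (⟦y x⟧ : Quotient (Perm.SameCycle.setoid g)) = κ x) →
      (y * g.twist γ hγ ^ 2) ^ n = g ^ m ∧ (a * (y * g.twist γ hγ ^ 2)) ^ n = g ^ m := by
  by_cases hκ : ∃ y : Perm α, y ^ n = g ∧ (a * y) ^ n = g ∧
      ∀ x, (⟦y x⟧ : Quotient (Perm.SameCycle.setoid g)) = κ x
  · obtain ⟨y, hy, hay, hyκ⟩ := hκ
    obtain ⟨γ, hγ, hγm⟩ := exists_twist hn hm hy hay
    refine ⟨γ, hγ, fun y' hy' hay' hyκ' => ?_⟩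
    have hγ2 : ∀ x, 2 * γ (g x) = 2 * γ x := fun x => by rw [hγ]
    have hcyc (x : α) : g.SameCycle (y x) (y' x) :=
      Quotient.exact ((hyκ x).trans (hyκ' x).symm)
    have hag : Commute a g := commute_of_commonRoot hy hay
    have hcyc' (x : α) : g.SameCycle ((a * y) x) ((a * y') x) := by
      obtain ⟨k, hk⟩ := hcyc x
      exact ⟨k, by rw [mul_apply, mul_apply, ← hk, ← mul_apply, ← mul_apply a,
        (hag.zpow_right k).eq, mul_apply]⟩
    rw [← twist_two_mul γ hγ hγ2, ← mul_assoc]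
    constructor
    · refine mul_twist_pow_eq hy' _ _ fun x => ?_
      convert (hγm x).1 using 4 with j
      exact ((sameCycle_pow_apply (hy ▸ Commute.self_pow y _) hcyc j x).apply_eq_of_invariant
        hγ).symm
    · refine mul_twist_pow_eq hay' _ _ fun x => ?_
      convert (hγm x).2 using 4 with j
      exact ((sameCycle_pow_apply (hay ▸ Commute.self_pow (a * y) _) hcyc'
        j x).apply_eq_of_invariant hγ).symm
  -- No common root induces κ, so 0 is a default.
  · exact ⟨0, fun _ => rfl, fun y hy hay hyκ => absurd ⟨y, hy, hay, hyκ⟩ hκ⟩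

/-- The twist moves points only within g-cycles, so F y and y induce the same map to g-cycles. Thus
F y determines the twist, and cancelling it recovers y. -/
theorem commonRootCount_le_pow {H : Subgroup (Perm α)} [Fintype H] [DecidableEq H]
    (hH : ∀ σ : Perm α, σ ^ 2 ∈ H) {n m : ℕ} (hn : 0 < n) (a g : H)
    (hm : m.Coprime (orderOf g)) : commonRootCount n a g ≤ commonRootCount n a (g ^ m) := by
  rw [← Subgroup.orderOf_coe] at hm
  choose γ hγ hγm using Equiv.Perm.exists_twist_of_key hn hm (a : Perm α)
  let key (y : Perm α) : α → Quotient (Perm.SameCycle.setoid (g : Perm α)) := fun x => ⟦y x⟧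
  let F (y : H) : H := y * ⟨(g : Perm α).twist (γ (key y)) (hγ (key y)) ^ 2, hH _⟩
  have hkey (y : H) (hy : y ^ n = g) : key (F y) = key y := by
    ext1 x
    refine Quotient.sound (?_ : (g : Perm α).SameCycle _ _)
    have hyg : Commute (y : Perm α) g := by
      have : Commute y g := hy ▸ Commute.self_pow y _
      exact congrArg Subtype.val this
    change (g : Perm α).SameCycle ((y * (g : Perm α).twist (γ (key y)) (hγ (key y)) ^ 2) x) _
    rw [← Perm.twist_two_mul _ _ fun x => by rw [hγ], Perm.mul_apply, Perm.twist_apply,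
      ← Perm.mul_apply, (hyg.pow_right _).eq, Perm.mul_apply, Perm.sameCycle_pow_left]
  refine Finset.card_le_card_of_injOn F ?_ ?_
  · intro y hy
    simp only [Finset.coe_filter, Finset.mem_univ, true_and, Set.mem_ofPred_eq,
      Subtype.ext_iff] at hy ⊢
    exact hγm (key y) y hy.1 hy.2 fun _ => rfl
  · intro y hy y' hy' hF
    simp only [Finset.coe_filter, Finset.mem_univ, true_and, Set.mem_ofPred_eq] at hy hy'
    have h := congrArg (fun w : H => key w) hF
    simp only [hkey y hy.1, hkey y' hy'.1] at h
    simp only [F, h] at hF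
    exact mul_right_cancel hF

/-- A group of permutations that contains all squares is an `FSZ`-group. -/
theorem isFSZ_of_sq_mem {H : Subgroup (Perm α)} [Fintype H] [DecidableEq H]
    (hH : ∀ σ : Perm α, σ ^ 2 ∈ H) : IsFSZ H := by
  intro n hn
  refine isFSZn_of_commonRootCount_pow_eq hn fun a g m hm => ?_
  have hle {k : ℕ} (hk : k.Coprime (Fintype.card H)) (h : H) :=
    commonRootCount_le_pow hH hn a h (hk.coprime_dvd_right (orderOf_dvd_card (x := h)))
  refine le_antisymm ?_ (hle hm g)
  -- Raising to the inverse exponent k brings g ^ m back to g.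
  obtain ⟨k, -, hk⟩ := Nat.exists_mul_mod_eq_of_coprime 1 hm Fintype.card_ne_zero
  have hk' : m * k ≡ 1 [MOD Fintype.card H] := hk
  have hkc : k.Coprime (Fintype.card H) :=
    Nat.Coprime.coprime_mul_left (k := m) (by
      rw [Nat.coprime_iff_gcd_eq_one, hk'.gcd_eq, Nat.gcd_one_left])
  have h := hle hkc (g ^ m)
  rwa [← pow_mul, pow_eq_pow_iff_modEq.2 (hk'.of_dvd (orderOf_dvd_card (x := g))), pow_one] at h

end CommonRoots

theorem mainTheorem8 (N : ℕ) : IsFSZ (alternatingGroup (Fin N)) := by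
  refine isFSZ_of_sq_mem fun σ => ?_
  rw [Equiv.Perm.mem_alternatingGroup, map_pow, Int.units_sq]
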